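/- Let $\alpha<0$ be real and put $\varkappa_\alpha=\frac{\alpha-1}{\alpha}$ (so $\varkappa_\alpha>1$), $N_\alpha=\max\{3,\lfloor\varkappa_\alpha\rfloor+1\}$ and $\omega_\alpha=\log(1-2\alpha)$. For $n\ge 3$ let $L_{\alpha,n}$ be the $n\times n$ Laplacian matrix of the cyclic graph on the vertices $1,\dots,n$ in which the edge between $1$ and $n$ has weight $\alpha$ and all other edges have weight $1$; thus its diagonal is $(1+\alpha,2,\dots,2,1+\alpha)$, the entries next to the diagonal are $-1$, the entries $(1,n)$ and $(n,1)$ are $-\alpha$, and all other entries are $0$. Let $\lambda_{\alpha,n,1}$ be its smallest eigenvalue. For $x\ge0$ put \[ \varphi_{\alpha,n}(x)=2\operatorname{arctanh}\Bigl(\varkappa_\alpha^{-1}\tanh\frac{nx}{2}\Bigr),\qquad f_{\alpha,n}(x)=x-\varphi_{\alpha,n}(x),\qquad g_-(x)=2-2\cosh x, \] where $g_-$ is a bijection from $[0,\infty)$ onto $(-\infty,0]$, and let \[ \ell_{\alpha,n}=\frac2n\operatorname{arccosh}\sqrt{\frac{n\alpha(\alpha-1)-\alpha^2}{1-2\alpha}},\qquad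 s_{\alpha,n}=g_-^{-1}(\lambda_{\alpha,n,1}). \] Let $n\ge N_\alpha$. Then the following hold. 1. $\varphi_{\alpha,n}(\ell_{\alpha,n})<\omega_\alpha$, and $\varphi_{\alpha,n}$ is a contraction on the segment $[\varphi_{\alpha,n}(\ell_{\alpha,n}),\omega_\alpha]$: it maps this segment into itself and is Lipschitz continuous on it with some constant $K<1$. 2. The point $s_{\alpha,n}$ is well defined and positive: $s_{\alpha,n}>0$ and $g_-(s_{\alpha,n})=\lambda_{\alpha,n,1}$. Newton's method for $f_{\alpha,n}$ started at $\omega_\alpha$, \[ y_{\alpha,n}^{(0)}=\omega_\alpha,\qquad y_{\alpha,n}^{(m)}=y_{\alpha,n}^{(m-1)}-\frac{f_{\alpha,n}\bigl(y_{\alpha,n}^{(m-1)}\bigr)}{f_{\alpha,n}'\bigl(y_{\alpha,n}^{(m-1)}\bigr)}\qquad(m\ge1), \] is well defined (at each $y_{\alpha,n}^{(m)}$ the function $f_{\alpha,n}$ is differentiable with nonzero derivative), $y_{\alpha,n}^{(m)}\in[s_{\alpha,n},\omega_\alpha]$ for every $m\ge0$, and $y_{\alpha,n}^{(m)}\to s_{\alpha,n}$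 as $m\to\infty$. -/

import Mathlib

open Set Filter Topology
open scoped NNReal

noncomputable section

namespace WeightedCycle

/-- The Laplacian matrix `L_{α,n}` of the cyclic graph with `n ≥ 3` vertices in which the edge
joining the first and the last vertex has weight `α` and every other edge has weight `1`.
Vertices are numbered from `0` to `n - 1`. -/
def laplacian (α : ℝ) (n : ℕ) : Matrix (Fin n) (Fin n) ℝ :=
  Matrix.of fun i j =>
    if i = j then (if i.val = 0 ∨ i.val + 1 = n then 1 + α else 2)
    else if i.val + 1 = j.val ∨ j.val + 1 = i.val then -1
    else if (i.val = 0 ∧ j.val + 1 = n) ∨ (j.val = 0 ∧ i.val + 1 = n) then -α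
    else 0

/-- The smallest eigenvalue `λ_{α,n,1}` of `L_{α,n}`. -/
def firstEigenvalue (α : ℝ) (n : ℕ) : ℝ :=
  sInf (spectrum ℝ (laplacian α n))

theorem laplacian_isHermitian (α : ℝ) (n : ℕ) : (laplacian α n).IsHermitian := by
  ext i j
  simp only [Matrix.conjTranspose_apply, laplacian, Matrix.of_apply, star_trivial]
  by_cases h : i = j
  · subst h; rfl
  · rw [if_neg h, if_neg (Ne.symm h)]
    simp only [or_comm]

/-- The infimum in the definition of `firstEigenvalue` is a minimum. -/
theorem firstEigenvalue_isLeast (α : ℝ) (n : ℕ) (hn : 1 ≤ n) :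
    IsLeast (spectrum ℝ (laplacian α n)) (firstEigenvalue α n) := by
  have hfin : (spectrum ℝ (laplacian α n)).Finite := Matrix.finite_real_spectrum
  have hne : (spectrum ℝ (laplacian α n)).Nonempty := by
    rw [(laplacian_isHermitian α n).spectrum_real_eq_range_eigenvalues]
    exact ⟨_, ⟨⟨0, hn⟩, rfl⟩⟩
  exact ⟨hne.csInf_mem hfin, fun x hx => csInf_le hfin.bddBelow hx⟩

/-- `ϰ_α = (α - 1) / α`. -/
def kappa (α : ℝ) : ℝ := (α - 1) / α

/-- `N_α = max {3, ⌊ϰ_α⌋ + 1}`; note that `ϰ_α > 1` when `α < 0`. -/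
def threshold (α : ℝ) : ℕ := max 3 (⌊kappa α⌋₊ + 1)

/-- `g_-(x) = 2 - 2 cosh x`, to be considered for `x ≥ 0`. -/
def gMinus (x : ℝ) : ℝ := 2 - 2 * Real.cosh x

/-- `g_-` is a bijection from `[0, ∞)` onto `(-∞, 0]`. -/
theorem gMinus_bijOn : BijOn gMinus (Ici 0) (Iic 0) := by
  refine ⟨fun x _ => ?_, fun x hx y hy h => ?_, fun y hy => ?_⟩
  · have := Real.one_le_cosh x
    simp only [gMinus, mem_Iic]; linarith
  · have h' : Real.cosh x = Real.cosh y := by simp only [gMinus] at h; linarith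
    exact Real.cosh_strictMonoOn.injOn hx hy h'
  · have hy' : y ≤ 0 := hy
    refine ⟨Real.arcosh (1 - y / 2), Real.arcosh_nonneg (by linarith), ?_⟩
    rw [gMinus, Real.cosh_arcosh (by linarith)]; ring

/-- `s_{α,n} = g_-⁻¹ (λ_{α,n,1})`, where `g_-` is regarded as a function on `[0, ∞)`. -/
def sPoint (α : ℝ) (n : ℕ) : ℝ :=
  Function.invFunOn gMinus (Ici 0) (firstEigenvalue α n)

/-- `φ_{α,n}(x) = 2 artanh (ϰ_α⁻¹ tanh (n x / 2))`. -/
def phi (α : ℝ) (n : ℕ) (x : ℝ) : ℝ :=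
  2 * Real.artanh ((kappa α)⁻¹ * Real.tanh (n * x / 2))

/-- `ω_α = log (1 - 2 α)`. -/
def omega (α : ℝ) : ℝ := Real.log (1 - 2 * α)

/-- `ℓ_{α,n} = (2 / n) arcosh √((n α (α - 1) - α²) / (1 - 2 α))`. -/
def ell (α : ℝ) (n : ℕ) : ℝ :=
  2 / n * Real.arcosh (Real.sqrt ((n * α * (α - 1) - α ^ 2) / (1 - 2 * α)))

/-- `f_{α,n}(x) = x - φ_{α,n}(x)`. -/
def fFun (α : ℝ) (n : ℕ) (x : ℝ) : ℝ := x - phi α n x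

/-- The Newton iterates `y_{α,n}^{(m)}` for `f_{α,n}` started at `ω_α`. -/
def newton (α : ℝ) (n : ℕ) : ℕ → ℝ
  | 0 => omega α
  | m + 1 => newton α n m - fFun α n (newton α n m) / deriv (fFun α n) (newton α n m)

end WeightedCycle

end

open WeightedCycle

namespace WeightedCycle

/-! On `[0, ∞)` the derivative of `φ` decreases strictly; it exceeds `1` before `ℓ`, equals `1`
there and is smaller afterwards. As `φ 0 = 0`, this gives `ℓ < φ ℓ`, while `φ < ω` everywhere; so
`φ` has a fixed point `s` in `(ℓ, ω)` and contracts `[φ ℓ, ω]`. Beyond `ℓ` the function `f = id - φ`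
is increasing and convex, so Newton's method started at `ω` descends to `s` (`newton_step`).

To identify `s` with `s_{α,n}`, the fixed-point equation is rewritten as the boundary condition
under which an odd `sinh` vector is an eigenvector for `g_-(s) < 0` (`laplacian_mulVec_sinh`). Only
the edge of weight `α` contributes negatively to the quadratic form, so there is at most one
negative eigenvalue (`eigenvalue_unique_of_neg`), and `g_-(s)` is the smallest. -/

/-! ### The map `φ`: derivative, monotonicity, upper bound -/

theorem kappa_inv_eq {α : ℝ} (hα : α < 0) : (kappa α)⁻¹ = -α / (1 - α) := by
  have h1 : α ≠ 0 := hα.ne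
  have h2 : α - 1 ≠ 0 := by linarith
  have h3 : 1 - α ≠ 0 := by linarith
  rw [kappa]
  field_simp
  ring

theorem kappa_inv_pos {α : ℝ} (hα : α < 0) : 0 < (kappa α)⁻¹ := by
  rw [kappa_inv_eq hα]
  exact div_pos (by linarith) (by linarith)

theorem kappa_inv_lt_one {α : ℝ} (hα : α < 0) : (kappa α)⁻¹ < 1 := by
  rw [kappa_inv_eq hα, div_lt_one (by linarith)]
  linarith

/-- The product is the slope of `φ` at `0`, so beyond the threshold `φ` leaves the origin above the
diagonal. -/
theorem one_lt_mul_kappa_inv {α : ℝ} (hα : α < 0) {n : ℕ} (hn : threshold α ≤ n) :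
    1 < n * (kappa α)⁻¹ := by
  have h1 : ⌊kappa α⌋₊ + 1 ≤ n := (le_max_right _ _).trans hn
  have h2 : kappa α < n := (Nat.lt_floor_add_one _).trans_le (by exact_mod_cast h1)
  have h3 : 0 < kappa α := inv_pos.mp (kappa_inv_pos hα)
  rwa [← div_eq_mul_inv, one_lt_div h3]

theorem three_le_of_threshold_le {α : ℝ} {n : ℕ} (hn : threshold α ≤ n) : 3 ≤ n :=
  (le_max_left _ _).trans hn

/-- The derivative of `φ_{α,n}`. -/
noncomputable def phiDeriv (α : ℝ) (n : ℕ) (x : ℝ) : ℝ :=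
  n * (kappa α)⁻¹ / (1 + (1 - (kappa α)⁻¹ ^ 2) * Real.sinh (n * x / 2) ^ 2)

theorem abs_sinh_lt_cosh (u : ℝ) : |Real.sinh u| < Real.cosh u :=
  abs_lt_of_sq_lt_sq (by rw [Real.cosh_sq]; linarith) (Real.cosh_pos u).le

theorem cosh_add_mul_sinh_pos {k : ℝ} (hk : |k| ≤ 1) (u : ℝ) :
    0 < Real.cosh u + k * Real.sinh u := by
  have h : |k * Real.sinh u| ≤ |Real.sinh u| := by
    rw [abs_mul]
    exact mul_le_of_le_one_left (abs_nonneg _) hk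
  linarith [neg_abs_le (k * Real.sinh u), abs_sinh_lt_cosh u]

/-- Clearing `cosh u` from the logarithmic form of `artanh` leaves an expression that is easy to
differentiate. -/
theorem two_mul_artanh_mul_tanh {k : ℝ} (hk : |k| ≤ 1) (u : ℝ) :
    2 * Real.artanh (k * Real.tanh u) =
      Real.log (Real.cosh u + k * Real.sinh u) - Real.log (Real.cosh u - k * Real.sinh u) := by
  have hc := Real.cosh_pos u
  have h1 := cosh_add_mul_sinh_pos hk u
  have h2 : 0 < Real.cosh u - k * Real.sinh u := by
    have := cosh_add_mul_sinh_pos (k := -k) (by rwa [abs_neg]) u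
    linarith
  have e : k * Real.tanh u = k * Real.sinh u / Real.cosh u := by
    rw [Real.tanh_eq_sinh_div_cosh]; ring
  have hmem : k * Real.tanh u ∈ Icc (-1 : ℝ) 1 := by
    rw [e]
    exact ⟨by rw [le_div_iff₀ hc]; linarith, by rw [div_le_iff₀ hc]; linarith⟩
  rw [Real.artanh_eq_half_log hmem, ← Real.log_div h1.ne' h2.ne', ← mul_assoc]
  norm_num
  congr 1
  rw [e]
  field_simp

theorem abs_kappa_inv_le {α : ℝ} (hα : α < 0) : |(kappa α)⁻¹| ≤ 1 := by
  rw [abs_of_pos (kappa_inv_pos hα)]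
  exact (kappa_inv_lt_one hα).le

theorem hasDerivAt_phi {α : ℝ} (hα : α < 0) (n : ℕ) (x : ℝ) :
    HasDerivAt (phi α n) (phiDeriv α n x) x := by
  have hk := abs_kappa_inv_le hα
  set k := (kappa α)⁻¹ with hkdef
  have e : phi α n = fun x => Real.log (Real.cosh (n * x / 2) + k * Real.sinh (n * x / 2)) -
      Real.log (Real.cosh (n * x / 2) - k * Real.sinh (n * x / 2)) := by
    funext x
    exact two_mul_artanh_mul_tanh hk _
  have hu : HasDerivAt (fun x : ℝ => (n : ℝ) * x / 2) ((n : ℝ) / 2) x := by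
    simpa using ((hasDerivAt_id x).const_mul (n : ℝ)).div_const 2
  have h1 := cosh_add_mul_sinh_pos hk (n * x / 2)
  have h2 : 0 < Real.cosh (n * x / 2) - k * Real.sinh (n * x / 2) := by
    have := cosh_add_mul_sinh_pos (k := -k) (by rwa [abs_neg]) (n * x / 2)
    linarith
  have hd := ((hu.cosh.add (hu.sinh.const_mul k)).log h1.ne').sub
    ((hu.cosh.sub (hu.sinh.const_mul k)).log h2.ne')
  rw [e]
  refine hd.congr_deriv (Eq.symm ?_)
  simp only [Pi.add_apply, Pi.sub_apply]
  rw [phiDeriv, ← hkdef, div_sub_div _ _ h1.ne' h2.ne', div_eq_div_iff]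
  · have hs := Real.cosh_sq (n * x / 2)
    generalize Real.cosh (n * x / 2) = C at *
    generalize Real.sinh (n * x / 2) = S at *
    have e1 : (C + k * S) * (C - k * S) = 1 + (1 - k ^ 2) * S ^ 2 := by linear_combination hs
    rw [e1]
    linear_combination -(n * k * (1 + (1 - k ^ 2) * S ^ 2)) * hs
  · have : (0 : ℝ) ≤ 1 - k ^ 2 := by nlinarith [sq_abs k, abs_nonneg k]
    positivity
  · exact (mul_pos h1 h2).ne'

theorem one_sub_kappa_inv_sq_pos {α : ℝ} (hα : α < 0) : 0 < 1 - (kappa α)⁻¹ ^ 2 := by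
  nlinarith [kappa_inv_pos hα, kappa_inv_lt_one hα]

theorem phiDeriv_pos {α : ℝ} (hα : α < 0) {n : ℕ} (hn : 0 < n) (x : ℝ) : 0 < phiDeriv α n x := by
  have h1 := one_sub_kappa_inv_sq_pos hα
  have h2 := kappa_inv_pos hα
  have h3 : (0 : ℝ) < n := by exact_mod_cast hn
  rw [phiDeriv]
  exact div_pos (by positivity) (by positivity)

theorem phiDeriv_strictAntiOn {α : ℝ} (hα : α < 0) {n : ℕ} (hn : 0 < n) :
    StrictAntiOn (phiDeriv α n) (Ici 0) := by
  intro x hx y hy hxy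
  have hx : 0 ≤ x := hx
  have h1 := one_sub_kappa_inv_sq_pos hα
  have h2 := kappa_inv_pos hα
  have h3 : (0 : ℝ) < n := by exact_mod_cast hn
  have h4 : 0 ≤ Real.sinh (n * x / 2) := Real.sinh_nonneg_iff.mpr (by positivity)
  have h5 : Real.sinh (n * x / 2) < Real.sinh (n * y / 2) := Real.sinh_lt_sinh.mpr (by gcongr)
  simp only [phiDeriv]
  gcongr

theorem strictMono_phi {α : ℝ} (hα : α < 0) {n : ℕ} (hn : 0 < n) : StrictMono (phi α n) :=
  strictMono_of_hasDerivAt_pos (hasDerivAt_phi hα n) fun x => phiDeriv_pos hα hn x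

theorem phi_zero (α : ℝ) (n : ℕ) : phi α n 0 = 0 := by
  simp [phi]

/-- This exhibits `ω` as the value that `φ` approaches when `tanh` tends to `1`, hence as a strict
upper bound. -/
theorem omega_eq {α : ℝ} (hα : α < 0) : omega α = 2 * Real.artanh (kappa α)⁻¹ := by
  have hk := kappa_inv_pos hα
  have hk1 := kappa_inv_lt_one hα
  rw [Real.artanh_eq_half_log ⟨by linarith, hk1.le⟩, omega, kappa_inv_eq hα, ← mul_assoc]
  have h3 : 1 - α ≠ 0 := by linarith
  norm_num
  congr 1
  rw [one_add_div h3, one_sub_div h3, div_div_div_cancel_right₀ h3]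
  ring

theorem phi_lt_omega {α : ℝ} (hα : α < 0) (n : ℕ) (x : ℝ) : phi α n x < omega α := by
  have hk := kappa_inv_pos hα
  have hk1 := kappa_inv_lt_one hα
  have ht := Real.tanh_bijOn.mapsTo (mem_univ (n * x / 2))
  rw [omega_eq hα, phi]
  have := Real.artanh_lt_artanh (x := (kappa α)⁻¹ * Real.tanh (n * x / 2)) (y := (kappa α)⁻¹)
    (by nlinarith [ht.1]) hk1 (by nlinarith [ht.2])
  linarith

/-! ### The critical point `ℓ` and the fixed point -/

theorem cosh_sq_ell {α : ℝ} (hα : α < 0) {n : ℕ} (hn : threshold α ≤ n) :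
    0 < ell α n ∧ Real.cosh (n * ell α n / 2) ^ 2 =
      (n * α * (α - 1) - α ^ 2) / (1 - 2 * α) := by
  have hn0 : (0 : ℝ) < n := by have := three_le_of_threshold_le hn; positivity
  have h1 := one_lt_mul_kappa_inv hα hn
  rw [kappa_inv_eq hα, mul_div_assoc', one_lt_div (by linarith)] at h1
  -- After division by `1 - α` this is the slope condition `n * ϰ⁻¹ > 1`.
  have hq : 1 < (n * α * (α - 1) - α ^ 2) / (1 - 2 * α) := by
    rw [one_lt_div (by linarith)]
    nlinarith
  have hq' : 1 < Real.sqrt ((n * α * (α - 1) - α ^ 2) / (1 - 2 * α)) := by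
    rw [Real.lt_sqrt (by norm_num)]
    simpa using hq
  have hpos := Real.arcosh_pos hq'
  refine ⟨mul_pos (by positivity) hpos, ?_⟩
  have e : n * ell α n / 2 =
      Real.arcosh (Real.sqrt ((n * α * (α - 1) - α ^ 2) / (1 - 2 * α))) := by
    rw [ell]; field_simp
  rw [e, Real.cosh_arcosh hq'.le, Real.sq_sqrt (by linarith)]

theorem phiDeriv_ell {α : ℝ} (hα : α < 0) {n : ℕ} (hn : threshold α ≤ n) :
    phiDeriv α n (ell α n) = 1 := by
  have h := (cosh_sq_ell hα hn).2
  have hk := one_sub_kappa_inv_sq_pos hα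
  rw [Real.cosh_sq, ← eq_sub_iff_add_eq] at h
  rw [phiDeriv, div_eq_one_iff_eq (by positivity), h, kappa_inv_eq hα]
  have h3 : 1 - α ≠ 0 := by linarith
  have h4 : 1 - 2 * α ≠ 0 := by linarith
  have e : 1 - (-α / (1 - α)) ^ 2 = (1 - 2 * α) / (1 - α) ^ 2 := by
    field_simp
    ring
  rw [e, div_mul_eq_mul_div, mul_sub, mul_div_cancel₀ _ h4]
  field_simp
  ring

theorem phiDeriv_lt_one {α : ℝ} (hα : α < 0) {n : ℕ} (hn : threshold α ≤ n) {x : ℝ}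
    (hx : ell α n < x) : phiDeriv α n x < 1 := by
  have hl := (cosh_sq_ell hα hn).1
  rw [← phiDeriv_ell hα hn]
  exact phiDeriv_strictAntiOn hα (by have := three_le_of_threshold_le hn; omega) hl.le
    (hl.trans hx).le hx

theorem hasDerivAt_fFun {α : ℝ} (hα : α < 0) (n : ℕ) (x : ℝ) :
    HasDerivAt (fFun α n) (1 - phiDeriv α n x) x :=
  (hasDerivAt_id x).sub (hasDerivAt_phi hα n x)

theorem exists_fFun_sub_eq {α : ℝ} (hα : α < 0) (n : ℕ) {x y : ℝ} (hxy : x < y) :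
    ∃ c ∈ Ioo x y, fFun α n y - fFun α n x = (1 - phiDeriv α n c) * (y - x) := by
  obtain ⟨c, hc, h⟩ := exists_hasDerivAt_eq_slope (fFun α n) (fun x => 1 - phiDeriv α n x) hxy
    (fun z _ => (hasDerivAt_fFun hα n z).continuousAt.continuousWithinAt)
    (fun z _ => hasDerivAt_fFun hα n z)
  refine ⟨c, hc, ?_⟩
  rw [h, div_mul_cancel₀ _ (by linarith)]

/-- Between `0` and `ℓ` the slope of `φ` exceeds `1`, and `φ` starts on the diagonal. -/
theorem ell_lt_phi_ell {α : ℝ} (hα : α < 0) {n : ℕ} (hn : threshold α ≤ n) :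
    ell α n < phi α n (ell α n) := by
  have hn3 := three_le_of_threshold_le hn
  have hl := (cosh_sq_ell hα hn).1
  obtain ⟨c, hc, h⟩ := exists_fFun_sub_eq hα n hl
  have h1 : 1 < phiDeriv α n c := by
    rw [← phiDeriv_ell hα hn]
    exact phiDeriv_strictAntiOn hα (by omega) hc.1.le hl.le hc.2
  simp only [fFun, phi_zero, sub_zero] at h
  nlinarith

theorem exists_fixedPoint {α : ℝ} (hα : α < 0) {n : ℕ} (hn : threshold α ≤ n) :
    ∃ s, ell α n < s ∧ s < omega α ∧ phi α n s = s := by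
  have h1 := ell_lt_phi_ell hα hn
  have h2 := phi_lt_omega hα n (ell α n)
  have h3 := phi_lt_omega hα n (omega α)
  have hc : ContinuousOn (fFun α n) (Icc (ell α n) (omega α)) :=
    fun z _ => (hasDerivAt_fFun hα n z).continuousAt.continuousWithinAt
  obtain ⟨s, hs, h⟩ := intermediate_value_Ioo (h1.trans h2).le hc
    (show (0 : ℝ) ∈ Ioo _ _ from ⟨by simp only [fFun]; linarith, by simp only [fFun]; linarith⟩)
  exact ⟨s, hs.1, hs.2, by simp only [fFun] at h; linarith⟩

/-! ### Contraction and Newton's method -/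

theorem contracting_phi {α : ℝ} (hα : α < 0) {n : ℕ} (hn : threshold α ≤ n) :
    ∃ h : MapsTo (phi α n) (Icc (phi α n (ell α n)) (omega α))
        (Icc (phi α n (ell α n)) (omega α)),
      ∃ K : ℝ≥0, ContractingWith K h.restrict := by
  have hn0 : 0 < n := by have := three_le_of_threshold_le hn; omega
  have hl := (cosh_sq_ell hα hn).1
  have hlp := ell_lt_phi_ell hα hn
  have hmono := (strictMono_phi hα hn0).monotone
  -- The slope decreases, so its value at the left endpoint is a Lipschitz constant; it is below `1`
  -- because that endpoint lies beyond `ℓ`.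
  refine ⟨fun x hx => ⟨hmono (hlp.le.trans hx.1), (phi_lt_omega hα n x).le⟩,
    (phiDeriv α n (phi α n (ell α n))).toNNReal, ?_, ?_⟩
  · rw [Real.toNNReal_lt_one]
    exact phiDeriv_lt_one hα hn hlp
  · have hL : LipschitzOnWith (phiDeriv α n (phi α n (ell α n))).toNNReal
        (phi α n) (Icc (phi α n (ell α n)) (omega α)) := by
      refine (convex_Icc _ _).lipschitzOnWith_of_nnnorm_hasDerivWithin_le
        (fun x _ => (hasDerivAt_phi hα n x).hasDerivWithinAt) fun x hx => ?_
      rw [← NNReal.coe_le_coe, coe_nnnorm, Real.norm_of_nonneg (phiDeriv_pos hα hn0 _).le,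
        Real.coe_toNNReal _ (phiDeriv_pos hα hn0 _).le]
      exact (phiDeriv_strictAntiOn hα hn0).antitoneOn (hl.trans hlp).le
        ((hl.trans hlp).le.trans hx.1) hx.1
    exact fun x y => hL x.2 y.2

/-- By the mean value theorem and the monotonicity of `f'`, `f y` lies between `f' s * (y - s)` and
`f' y * (y - s)`. The upper bound prevents overshooting `s`. Since `0 < f' y ≤ 1`, a Newton step
moves at least as far as the step `y ↦ φ y`, and the lower bound then gives the factor `φ' s`. -/
theorem newton_step {α : ℝ} (hα : α < 0) {n : ℕ} (hn : threshold α ≤ n) {s y : ℝ}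
    (hs : ell α n < s) (hfix : phi α n s = s) (hy : s ≤ y) :
    0 < 1 - phiDeriv α n y ∧
    s ≤ y - fFun α n y / (1 - phiDeriv α n y) ∧
    y - fFun α n y / (1 - phiDeriv α n y) ≤ y ∧
    y - fFun α n y / (1 - phiDeriv α n y) - s ≤ phiDeriv α n s * (y - s) := by
  have hn0 : 0 < n := by have := three_le_of_threshold_le hn; omega
  have hl := (cosh_sq_ell hα hn).1
  have hd : 0 < 1 - phiDeriv α n y := by linarith [phiDeriv_lt_one hα hn (hs.trans_le hy)]
  have hds : 0 < 1 - phiDeriv α n s := by linarith [phiDeriv_lt_one hα hn hs]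
  have hpos := phiDeriv_pos hα hn0 y
  have hf : fFun α n y ≤ (1 - phiDeriv α n y) * (y - s) ∧
      (1 - phiDeriv α n s) * (y - s) ≤ fFun α n y := by
    rcases hy.eq_or_lt with rfl | hlt
    · simp [fFun, hfix]
    · obtain ⟨c, hc, h⟩ := exists_fFun_sub_eq hα n hlt
      have h0 : fFun α n s = 0 := by simp [fFun, hfix]
      have hanti := (phiDeriv_strictAntiOn hα hn0).antitoneOn
      have h1 := hanti (mem_Ici.mpr (hl.trans hs).le) (mem_Ici.mpr ((hl.trans hs).trans hc.1).le) hc.1.le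
      have h2 := hanti (mem_Ici.mpr ((hl.trans hs).trans hc.1).le)
        (mem_Ici.mpr ((hl.trans hs).trans hlt).le) hc.2.le
      rw [h0, sub_zero] at h
      rw [h]
      constructor <;> gcongr
  have hnn : 0 ≤ fFun α n y := (mul_nonneg hds.le (sub_nonneg.mpr hy)).trans hf.2
  have h1 : fFun α n y / (1 - phiDeriv α n y) ≤ y - s := by
    rw [div_le_iff₀ hd]; linarith [hf.1]
  have h2 : fFun α n y ≤ fFun α n y / (1 - phiDeriv α n y) := le_div_self hnn hd (by linarith)
  exact ⟨hd, by linarith, by linarith, by linarith [hf.2]⟩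

theorem newton_spec {α : ℝ} (hα : α < 0) {n : ℕ} (hn : threshold α ≤ n) {s : ℝ}
    (hs : ell α n < s) (hsω : s < omega α) (hfix : phi α n s = s) (m : ℕ) :
    newton α n m ∈ Icc s (omega α) ∧
      newton α n m - s ≤ phiDeriv α n s ^ m * (omega α - s) := by
  have hn0 : 0 < n := by have := three_le_of_threshold_le hn; omega
  induction m with
  | zero => exact ⟨⟨hsω.le, le_rfl⟩, by simp [newton]⟩
  | succ m ih =>
    obtain ⟨-, h1, h2, h3⟩ := newton_step hα hn hs hfix ih.1.1
    rw [newton, (hasDerivAt_fFun hα n _).deriv]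
    refine ⟨⟨h1, h2.trans ih.1.2⟩, h3.trans ?_⟩
    rw [pow_succ', mul_assoc]
    exact mul_le_mul_of_nonneg_left ih.2 (phiDeriv_pos hα hn0 s).le

theorem tendsto_newton {α : ℝ} (hα : α < 0) {n : ℕ} (hn : threshold α ≤ n) {s : ℝ}
    (hs : ell α n < s) (hsω : s < omega α) (hfix : phi α n s = s) :
    Tendsto (newton α n) atTop (𝓝 s) := by
  have hn0 : 0 < n := by have := three_le_of_threshold_le hn; omega
  have h := newton_spec hα hn hs hsω hfix
  have hlim : Tendsto (fun m => s + phiDeriv α n s ^ m * (omega α - s)) atTop (𝓝 s) := by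
    simpa using ((tendsto_pow_atTop_nhds_zero_of_lt_one (phiDeriv_pos hα hn0 s).le
      (phiDeriv_lt_one hα hn hs)).mul_const (omega α - s)).const_add s
  exact tendsto_of_tendsto_of_tendsto_of_le_of_le tendsto_const_nhds hlim
    (fun m => (h m).1.1) (fun m => by linarith [(h m).2])

/-! ### The Laplacian: rows, quadratic form, negative eigenvalues -/

open Matrix

theorem laplacian_mulVec_interior (α : ℝ) (k m : ℕ) (f : ℕ → ℝ) (h : k + 2 < m) :
    (laplacian α m *ᵥ fun j => f j) ⟨k + 1, by omega⟩ = 2 * f (k + 1) - f k - f (k + 2) := by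
  have e : ∀ j : Fin m, laplacian α m ⟨k + 1, by omega⟩ j =
      (if (⟨k + 1, by omega⟩ : Fin m) = j then 2 else 0) -
      (if (⟨k, by omega⟩ : Fin m) = j then 1 else 0) -
      (if (⟨k + 2, by omega⟩ : Fin m) = j then 1 else 0) := by
    intro j
    simp only [laplacian, of_apply, Fin.ext_iff]
    grind
  simp only [mulVec, dotProduct, e, sub_mul, ite_mul, zero_mul, one_mul, Finset.sum_sub_distrib,
    Finset.sum_ite_eq, Finset.mem_univ, if_true]

/-- The bound `3 ≤ m` keeps the columns `0`, `1` and `m - 1` distinct. -/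
theorem laplacian_mulVec_first (α : ℝ) (m : ℕ) (f : ℕ → ℝ) (h : 3 ≤ m) :
    (laplacian α m *ᵥ fun j => f j) ⟨0, by omega⟩ = (1 + α) * f 0 - f 1 - α * f (m - 1) := by
  have e : ∀ j : Fin m, laplacian α m ⟨0, by omega⟩ j =
      (if (⟨0, by omega⟩ : Fin m) = j then 1 + α else 0) -
      (if (⟨1, by omega⟩ : Fin m) = j then 1 else 0) -
      (if (⟨m - 1, by omega⟩ : Fin m) = j then α else 0) := by
    intro j
    simp only [laplacian, of_apply, Fin.ext_iff]
    grind
  simp only [mulVec, dotProduct, e, sub_mul, ite_mul, zero_mul, one_mul, Finset.sum_sub_distrib,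
    Finset.sum_ite_eq, Finset.mem_univ, if_true]

theorem laplacian_mulVec_last (α : ℝ) (m : ℕ) (f : ℕ → ℝ) (h : 3 ≤ m) :
    (laplacian α m *ᵥ fun j => f j) ⟨m - 1, by omega⟩ =
      (1 + α) * f (m - 1) - f (m - 2) - α * f 0 := by
  have e : ∀ j : Fin m, laplacian α m ⟨m - 1, by omega⟩ j =
      (if (⟨m - 1, by omega⟩ : Fin m) = j then 1 + α else 0) -
      (if (⟨m - 2, by omega⟩ : Fin m) = j then 1 else 0) -
      (if (⟨0, by omega⟩ : Fin m) = j then α else 0) := by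
    intro j
    simp only [laplacian, of_apply, Fin.ext_iff]
    grind
  simp only [mulVec, dotProduct, e, sub_mul, ite_mul, zero_mul, one_mul, Finset.sum_sub_distrib,
    Finset.sum_ite_eq, Finset.mem_univ, if_true]

theorem laplacian_mulVec_eq_smul {α : ℝ} {m : ℕ} (h : 3 ≤ m) {f : ℕ → ℝ} {μ : ℝ}
    (h0 : (1 + α) * f 0 - f 1 - α * f (m - 1) = μ * f 0)
    (h1 : (1 + α) * f (m - 1) - f (m - 2) - α * f 0 = μ * f (m - 1))
    (hint : ∀ k, 2 * f (k + 1) - f k - f (k + 2) = μ * f (k + 1)) :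
    (laplacian α m *ᵥ fun j => f j) = μ • fun j : Fin m => f j := by
  funext ⟨i, hi⟩
  rw [Pi.smul_apply, smul_eq_mul]
  rcases i with _ | k
  · rw [laplacian_mulVec_first α m f h, h0]
  · by_cases hk : k + 2 < m
    · rw [laplacian_mulVec_interior α k m f hk, hint]
    · obtain rfl : m = k + 2 := by omega
      exact (laplacian_mulVec_last α (k + 2) f h).trans h1

theorem laplacian_row_sum (α : ℝ) {m : ℕ} (h : 3 ≤ m) (i : Fin m) :
    ∑ j, laplacian α m i j = 0 := by
  have := laplacian_mulVec_eq_smul (α := α) h (f := fun _ => 1) (μ := 0) (by ring) (by ring)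
    (fun _ => by ring)
  simpa [mulVec, dotProduct] using congrFun this i

/-- Expanding the squares, the pure square terms vanish by the zero row sums and symmetry. Each
unordered pair occurs twice, hence the `2`. -/
theorem dotProduct_mulVec_eq_sum_sq {ι : Type*} [Fintype ι] {A : Matrix ι ι ℝ}
    (hA : A.IsSymm) (hrow : ∀ i, ∑ j, A i j = 0) (w : ι → ℝ) :
    w ⬝ᵥ A *ᵥ w = ∑ i, ∑ j, -(A i j) * (w i - w j) ^ 2 / 2 := by
  have h1 : ∑ i, ∑ j, A i j * w i ^ 2 = 0 := by
    simp_rw [← Finset.sum_mul, hrow, zero_mul, Finset.sum_const_zero]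
  have h2 : ∑ i, ∑ j, A i j * w j ^ 2 = 0 := by
    rw [Finset.sum_comm, ← h1]
    exact Finset.sum_congr rfl fun i _ => Finset.sum_congr rfl fun j _ => by rw [hA.apply]
  have e : ∀ i j, -(A i j) * (w i - w j) ^ 2 / 2 =
      w i * (A i j * w j) - A i j * w i ^ 2 / 2 - A i j * w j ^ 2 / 2 := fun i j => by ring
  simp_rw [e, Finset.sum_sub_distrib, ← Finset.sum_div, h1, h2, dotProduct, mulVec, dotProduct,
    Finset.mul_sum]
  ring

/-- The only off-diagonal entries that can be positive are the two corners, and `hw` kills their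
terms. -/
theorem laplacian_quadratic_form_nonneg {α : ℝ} {m : ℕ} (h : 3 ≤ m) {w : Fin m → ℝ}
    (hw : w ⟨0, by omega⟩ = w ⟨m - 1, by omega⟩) : 0 ≤ w ⬝ᵥ laplacian α m *ᵥ w := by
  have hsymm : (laplacian α m).IsSymm := (isHermitian_iff_isSymm).mp (laplacian_isHermitian α m)
  rw [dotProduct_mulVec_eq_sum_sq hsymm (laplacian_row_sum α h)]
  refine Finset.sum_nonneg fun i _ => Finset.sum_nonneg fun j _ => ?_
  by_cases hij : w i = w j
  · simp [hij]
  · have : laplacian α m i j ≤ 0 := by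
      have h1 : i ≠ j := fun e => hij (by rw [e])
      have h2 : ¬ ((i.val = 0 ∧ j.val + 1 = m) ∨ (j.val = 0 ∧ i.val + 1 = m)) := by
        rintro (⟨a, b⟩ | ⟨a, b⟩)
        · apply hij
          have ej : j = ⟨m - 1, by omega⟩ := Fin.ext (by simp only; omega)
          rw [show i = ⟨0, by omega⟩ from Fin.ext a, hw, ← ej]
        · apply hij
          have ei : i = ⟨m - 1, by omega⟩ := Fin.ext (by simp only; omega)
          rw [show j = ⟨0, by omega⟩ from Fin.ext a, hw, ← ei]
      simp only [laplacian, of_apply, if_neg h1, if_neg h2]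
      split_ifs <;> norm_num
    have := neg_nonneg.mpr this
    positivity

/-- At most one eigenvalue of `L_{α,n}` is negative. -/
theorem eigenvalue_unique_of_neg {α : ℝ} {m : ℕ} (h : 3 ≤ m) {μ ν : ℝ} {u v : Fin m → ℝ}
    (hμ : μ < 0) (hν : ν < 0) (hu0 : u ≠ 0) (hv0 : v ≠ 0)
    (hu : laplacian α m *ᵥ u = μ • u) (hv : laplacian α m *ᵥ v = ν • v) : μ = ν := by
  by_contra hne
  have hsymm : (laplacian α m).IsSymm := (isHermitian_iff_isSymm).mp (laplacian_isHermitian α m)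
  have horth : u ⬝ᵥ v = 0 := by
    have e : u ⬝ᵥ laplacian α m *ᵥ v = v ⬝ᵥ laplacian α m *ᵥ u := by
      rw [dotProduct_mulVec, ← mulVec_transpose, hsymm.eq, dotProduct_comm]
    rw [hu, hv, dotProduct_smul, dotProduct_smul, dotProduct_comm v u, smul_eq_mul,
      smul_eq_mul] at e
    exact (mul_eq_zero.mp (show (μ - ν) * (u ⬝ᵥ v) = 0 by linarith)).resolve_left
      (sub_ne_zero.mpr hne)
  have hpos : ∀ x : Fin m → ℝ, x ≠ 0 → 0 < x ⬝ᵥ x := fun x hx => by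
    simpa using dotProduct_star_self_pos_iff.mpr hx
  -- On the hyperplane of equal end values the form is nonnegative, but on combinations of `u` and
  -- `v` it is negative definite. So the two meet only at zero.
  have key : ∀ a b : ℝ, a * (u ⟨0, by omega⟩ - u ⟨m - 1, by omega⟩) +
      b * (v ⟨0, by omega⟩ - v ⟨m - 1, by omega⟩) = 0 → a = 0 ∧ b = 0 := by
    intro a b hab
    have hq := laplacian_quadratic_form_nonneg (α := α) h (w := a • u + b • v)
      (by simp only [Pi.add_apply, Pi.smul_apply, smul_eq_mul]; linarith)
    simp only [mulVec_add, mulVec_smul, hu, hv, add_dotProduct, dotProduct_add, smul_dotProduct,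
      dotProduct_smul, smul_eq_mul, horth, dotProduct_comm v u] at hq
    have hq' : 0 ≤ a ^ 2 * (μ * (u ⬝ᵥ u)) + b ^ 2 * (ν * (v ⬝ᵥ v)) := by linarith
    have h1 := mul_neg_of_neg_of_pos hμ (hpos u hu0)
    have h2 := mul_neg_of_neg_of_pos hν (hpos v hv0)
    have h3 := mul_nonpos_of_nonneg_of_nonpos (sq_nonneg a) h1.le
    have h4 := mul_nonpos_of_nonneg_of_nonpos (sq_nonneg b) h2.le
    constructor
    · exact pow_eq_zero_iff (two_ne_zero) |>.mp
        ((mul_eq_zero.mp (show a ^ 2 * (μ * (u ⬝ᵥ u)) = 0 by linarith)).resolve_right h1.ne)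
    · exact pow_eq_zero_iff (two_ne_zero) |>.mp
        ((mul_eq_zero.mp (show b ^ 2 * (ν * (v ⬝ᵥ v)) = 0 by linarith)).resolve_right h2.ne)
  -- These coefficients always land in the hyperplane, so they vanish; then `u` itself lies in it, a
  -- contradiction.
  have h1 := key (v ⟨0, by omega⟩ - v ⟨m - 1, by omega⟩)
    (-(u ⟨0, by omega⟩ - u ⟨m - 1, by omega⟩)) (by ring)
  have h2 := key 1 0 (by rw [neg_eq_zero.mp h1.2]; ring)
  exact one_ne_zero h2.1

theorem mem_spectrum_iff_exists_mulVec {m : ℕ} (A : Matrix (Fin m) (Fin m) ℝ) (μ : ℝ) :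
    μ ∈ spectrum ℝ A ↔ ∃ v : Fin m → ℝ, v ≠ 0 ∧ A *ᵥ v = μ • v := by
  rw [← spectrum_toLin', ← Module.End.hasEigenvalue_iff_mem_spectrum]
  constructor
  · intro h
    obtain ⟨v, hv⟩ := h.exists_hasEigenvector
    exact ⟨v, hv.2, by simpa using hv.apply_eq_smul⟩
  · rintro ⟨v, hv0, hv⟩
    exact Module.End.hasEigenvalue_of_hasEigenvector
      (x := v) ⟨Module.End.mem_eigenspace_iff.mpr (by simpa using hv), hv0⟩

/-! ### The fixed point as an eigenvalue parameter -/

/-- Interior rows are the addition formula for `sinh`. The vector is odd about the centre `(m - 1) /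
2`, so both end rows reduce to the single condition `hs`. -/
theorem laplacian_mulVec_sinh {α : ℝ} {m : ℕ} (h : 3 ≤ m) {s : ℝ}
    (hs : Real.sinh ((m + 1) * s / 2) = (1 - 2 * α) * Real.sinh ((m - 1) * s / 2)) :
    (laplacian α m *ᵥ fun j => Real.sinh ((j - (m - 1) / 2) * s)) =
      gMinus s • fun j : Fin m => Real.sinh ((j - (m - 1) / 2) * s) := by
  have hrec : ∀ x : ℝ, 2 * Real.sinh x - Real.sinh (x - s) - Real.sinh (x + s) =
      gMinus s * Real.sinh x := fun x => by
    rw [Real.sinh_sub, Real.sinh_add, gMinus]; ring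
  have c1 : ((m - 1 : ℕ) : ℝ) = m - 1 := by rw [Nat.cast_sub (by omega)]; simp
  have c2 : ((m - 2 : ℕ) : ℝ) = m - 2 := by rw [Nat.cast_sub (by omega)]; simp
  have e0 : ((0 : ℝ) - (m - 1) / 2) * s = -((m - 1) * s / 2) := by ring
  have e1 : ((1 : ℝ) - (m - 1) / 2) * s = -((m - 1) * s / 2 - s) := by ring
  have e2 : ((m - 1 : ℝ) - (m - 1) / 2) * s = (m - 1) * s / 2 := by ring
  have e3 : ((m - 2 : ℝ) - (m - 1) / 2) * s = (m - 1) * s / 2 - s := by ring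
  have e4 : (m + 1) * s / 2 = (m - 1) * s / 2 + s := by ring
  have hr := hrec ((m - 1) * s / 2)
  rw [e4] at hs
  refine laplacian_mulVec_eq_smul h (f := fun j : ℕ => Real.sinh ((j - (m - 1) / 2) * s)) ?_ ?_
    fun k => ?_
  · simp only [Nat.cast_zero, Nat.cast_one, c1, e0, e1, e2, Real.sinh_neg]
    linear_combination -hr - hs
  · simp only [Nat.cast_zero, c1, c2, e0, e2, e3, Real.sinh_neg]
    linear_combination hr + hs
  · have := hrec ((((k + 1 : ℕ) : ℝ) - (m - 1) / 2) * s)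
    rw [← this]
    push_cast
    ring_nf

/-- The fixed-point equation says `tanh (s / 2) = ϰ⁻¹ * tanh (n * s / 2)`; cross-multiplying and
using the addition formulas yields the claim. -/
theorem sinh_eq_of_phi_eq {α : ℝ} (hα : α < 0) {n : ℕ} {s : ℝ} (hfix : phi α n s = s) :
    Real.sinh ((n + 1) * s / 2) = (1 - 2 * α) * Real.sinh ((n - 1) * s / 2) := by
  have hk := kappa_inv_pos hα
  have hk1 := kappa_inv_lt_one hα
  have ht := Real.tanh_bijOn.mapsTo (mem_univ (n * s / 2))
  have e : Real.tanh (s / 2) = (kappa α)⁻¹ * Real.tanh (n * s / 2) := by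
    rw [← Real.tanh_artanh (x := (kappa α)⁻¹ * Real.tanh (n * s / 2))
      ⟨by nlinarith [ht.1], by nlinarith [ht.2]⟩]
    congr 1
    rw [phi] at hfix
    linarith
  have h3 : 1 - α ≠ 0 := by linarith
  rw [kappa_inv_eq hα, Real.tanh_eq_sinh_div_cosh, Real.tanh_eq_sinh_div_cosh,
    div_mul_div_comm, div_eq_div_iff (Real.cosh_pos _).ne'
      (mul_ne_zero h3 (Real.cosh_pos _).ne')] at e
  rw [show (n + 1) * s / 2 = n * s / 2 + s / 2 by ring,
    show (n - 1) * s / 2 = n * s / 2 - s / 2 by ring, Real.sinh_add, Real.sinh_sub]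
  linear_combination 2 * e

theorem firstEigenvalue_eq {α : ℝ} (hα : α < 0) {n : ℕ} (hn : 3 ≤ n) {s : ℝ} (hs : 0 < s)
    (hfix : phi α n s = s) : firstEigenvalue α n = gMinus s := by
  have hneg : gMinus s < 0 := by
    have := Real.one_lt_cosh.mpr hs.ne'
    rw [gMinus]; linarith
  have hvec := laplacian_mulVec_sinh hn (sinh_eq_of_phi_eq hα hfix)
  have hvec0 : (fun j : Fin n => Real.sinh ((j - (n - 1) / 2) * s)) ≠ 0 := by
    intro h0
    have h1 := congrFun h0 ⟨0, by omega⟩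
    have h3 : (3 : ℝ) ≤ n := by exact_mod_cast hn
    simp only [Pi.zero_apply, Real.sinh_eq_zero, Nat.cast_zero] at h1
    nlinarith
  obtain ⟨hmem, hle⟩ := firstEigenvalue_isLeast α n (by omega)
  have hlt : firstEigenvalue α n ≤ gMinus s :=
    hle ((mem_spectrum_iff_exists_mulVec _ _).mpr ⟨_, hvec0, hvec⟩)
  obtain ⟨v, hv0, hv⟩ := (mem_spectrum_iff_exists_mulVec _ _).mp hmem
  -- The smallest eigenvalue is at most `g_-(s) < 0`, so both are negative and must coincide.
  exact eigenvalue_unique_of_neg hn (hlt.trans_lt hneg) hneg hv0 hvec0 hv hvec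

theorem sPoint_eq {α : ℝ} (hα : α < 0) {n : ℕ} (hn : 3 ≤ n) {s : ℝ} (hs : 0 < s)
    (hfix : phi α n s = s) : sPoint α n = s := by
  rw [sPoint, firstEigenvalue_eq hα hn hs hfix]
  exact gMinus_bijOn.injOn.leftInvOn_invFunOn hs.le

end WeightedCycle

theorem mainTheorem10 (α : ℝ) (hα : α < 0) (n : ℕ) (hn : threshold α ≤ n) :
    -- the interval is nondegenerate and `φ_{α,n}` is a contraction of it into itself
    (phi α n (ell α n) < omega α ∧
      ∃ h : MapsTo (phi α n) (Icc (phi α n (ell α n)) (omega α))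
          (Icc (phi α n (ell α n)) (omega α)),
        ∃ K : ℝ≥0, ContractingWith K h.restrict) ∧
    -- `s_{α,n}` is well defined by `g_-(s_{α,n}) = λ_{α,n,1}`
    (0 < sPoint α n ∧ gMinus (sPoint α n) = firstEigenvalue α n) ∧
    -- Newton's method is well defined, stays in `[s_{α,n}, ω_α]` and converges to `s_{α,n}`
    (∀ m : ℕ, DifferentiableAt ℝ (fFun α n) (newton α n m) ∧
      deriv (fFun α n) (newton α n m) ≠ 0) ∧
    (∀ m : ℕ, newton α n m ∈ Icc (sPoint α n) (omega α)) ∧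
    Tendsto (newton α n) atTop (𝓝 (sPoint α n)) := by
  obtain ⟨s, hs, hsω, hfix⟩ := exists_fixedPoint hα hn
  have hn3 := three_le_of_threshold_le hn
  have hs0 : 0 < s := (cosh_sq_ell hα hn).1.trans hs
  have hspec := newton_spec hα hn hs hsω hfix
  rw [sPoint_eq hα hn3 hs0 hfix]
  refine ⟨⟨phi_lt_omega hα n _, contracting_phi hα hn⟩,
    ⟨hs0, (firstEigenvalue_eq hα hn3 hs0 hfix).symm⟩, fun m => ?_, fun m => (hspec m).1,
    tendsto_newton hα hn hs hsω hfix⟩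
  have hd := hasDerivAt_fFun hα n (newton α n m)
  refine ⟨hd.differentiableAt, ?_⟩
  rw [hd.deriv]
  exact (newton_step hα hn hs hfix (hspec m).1.1).1.ne'
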